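/- Let $d\ge 1$, let $\mathcal S$ be the set of density matrices on $\mathbb C^d$, written in a fixed orthonormal basis $|0\rangle,\dots,|d-1\rangle$ (the incoherent basis), let $\Delta_d$ be the set of probability vectors in $\mathbb R^d$, and let $\Delta_d^\downarrow\subseteq\Delta_d$ be the subset of vectors with non-increasing entries. Order $\Delta_d^\downarrow$ by majorization: $u\preceq v$ iff $\sum_{i<j}u_i\le\sum_{i<j}v_i$ for all $j\le d$. Every subset of $\Delta_d^\downarrow$ has a supremum $\bigvee$ for this order. For a unit vector $\psi$ let $\mu^\downarrow(\psi)\in\Delta_d^\downarrow$ be the vector $(|\langle 0|\psi\rangle|^2,\dots,|\langle d-1|\psi\rangle|^2)$ rearranged in non-increasing order. The generalized coherence vector of $\rho\in\mathcal S$ is $$\nu(\rho)=\bigvee\Big\{\sum_{k=1}^M q_k\,\mu^\downarrow(\psi_k)\;:\;\rho=\sum_{k=1}^M q_k|\psi_k\rangle\langle\psi_k|,\ (q_k)_k\in\Delta_M,\ \|\psi_k\|=1,\ M\in\mathbb N\Big\}.$$ Let $\mathcal F$ be the class of functions $f:\Delta_d\to[0,1]$ that are concave, invariant under permutations of the entries,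 vanish at $(1,0,\dots,0)$ and attain their maximum at $(1/d,\dots,1/d)$. For $f\in\mathcal F$ put $C^{\mathrm{cv}}_f(\rho)=f(\nu(\rho))$. A state is incoherent if it is diagonal in the incoherent basis. A family $K_1,\dots,K_N$ of $d\times d$ matrices is a family of incoherent Kraus operators if $\sum_n K_n^\dagger K_n=I$ and for each $n$ there is a map $g_n:\{0,\dots,d-1\}\to\{0,\dots,d-1\}$ such that each $K_n|i\rangle$ is a (possibly zero) multiple of $|g_n(i)\rangle$. A map $\Lambda$ is an incoherent operation if $\Lambda(X)=\sum_n K_nXK_n^\dagger$ for some such family. A state $\rho$ is maximally coherent if for every $\sigma\in\mathcal S$ there is an incoherent operation $\Lambda$ with $\Lambda(\rho)=\sigma$. **Statement.** For every $f\in\mathcal F$ the following hold. 1. $C^{\mathrm{cv}}_f(\rho)=0$ for every incoherent state $\rho$. 2. $C^{\mathrm{cv}}_f(\Lambda(\rho))\le C^{\mathrm{cv}}_f(\rho)$ for every $\rho\in\mathcal S$ and every incoherent operation $\Lambda$. 3. For every $\rho\in\mathcal S$ and every family $K_1,\dots,K_N$ of incoherent Kraus operators, with $p_n=\operatorname{Tr}(K_n\rho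 K_n^\dagger)$ and $\sigma_n=K_n\rho K_n^\dagger/p_n$, one has $\sum_n p_n\,C^{\mathrm{cv}}_f(\sigma_n)\le C^{\mathrm{cv}}_f(\rho)$, where terms with $p_n=0$ count as $0$. 4. If $\rho$ is a maximally coherent state, then $C^{\mathrm{cv}}_f(\sigma)\le C^{\mathrm{cv}}_f(\rho)$ for all $\sigma\in\mathcal S$. The same holds for every state $\rho=U|\Psi\rangle\langle\Psi|U^\dagger$ with $|\Psi\rangle=\frac1{\sqrt d}\sum_i|i\rangle$ and $U=\sum_i e^{\mathrm i\theta_i}|\pi(i)\rangle\langle i|$, where $\pi$ is a permutation of $\{0,\dots,d-1\}$ and $\theta_i\in\mathbb R$. -/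

import Mathlib

open scoped Matrix ComplexOrder

/-- The sum of the first `j` entries of a vector. -/
def partialSum {d : ℕ} (u : Fin d → ℝ) (j : ℕ) : ℝ :=
  ∑ i : Fin d with i.val < j, u i

/-- The probability vectors of length `d` with entries in non-increasing order. -/
def OrderedProb (d : ℕ) : Type :=
  {u : Fin d → ℝ // u ∈ stdSimplex ℝ (Fin d) ∧ Antitone u}

theorem partialSum_succ {d : ℕ} (u : Fin d → ℝ) (i : Fin d) :
    partialSum u (i.val + 1) = partialSum u i.val + u i := by
  have h : (Finset.univ.filter fun k : Fin d => k.val < i.val + 1) =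
      insert i (Finset.univ.filter fun k : Fin d => k.val < i.val) := by
    ext k
    simp only [Finset.mem_filter, Finset.mem_univ, true_and, Finset.mem_insert, Fin.ext_iff]
    omega
  rw [partialSum, h, Finset.sum_insert (by simp), partialSum, add_comm]

theorem partialSum_injective {d : ℕ} {u v : Fin d → ℝ}
    (h : ∀ j, partialSum u j = partialSum v j) : u = v := by
  funext i
  have h1 := partialSum_succ u i
  have h2 := partialSum_succ v i
  rw [h, h] at h1
  linarith

/-- The majorization order on ordered probability vectors: since the entries are already sorted,
`u ≤ v` (read: `u` is majorized by `v`) compares the sums of the `j` largest entries. -/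
instance (d : ℕ) : PartialOrder (OrderedProb d) where
  le u v := ∀ j, partialSum u.1 j ≤ partialSum v.1 j
  le_refl _ _ := le_rfl
  le_trans _ _ _ h1 h2 j := (h1 j).trans (h2 j)
  le_antisymm _ _ h1 h2 :=
    Subtype.ext (partialSum_injective fun j => le_antisymm (h1 j) (h2 j))

theorem partialSum_succ_of_le {d : ℕ} (u : Fin d → ℝ) {n : ℕ} (h : d ≤ n) :
    partialSum u (n + 1) = partialSum u n := by
  unfold partialSum
  congr 1
  ext k
  have := k.isLt
  simp only [Finset.mem_filter, Finset.mem_univ, true_and]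
  omega

theorem partialSum_zero {d : ℕ} (u : Fin d → ℝ) : partialSum u 0 = 0 := by
  simp [partialSum]

theorem partialSum_full {d : ℕ} (u : Fin d → ℝ) : partialSum u d = ∑ i, u i := by
  simp [partialSum]

theorem partialSum_le_succ {d : ℕ} (v : OrderedProb d) (n : ℕ) :
    partialSum v.1 n ≤ partialSum v.1 (n + 1) := by
  by_cases h : n < d
  · have h1 := partialSum_succ v.1 ⟨n, h⟩
    have h2 := v.2.1.1 ⟨n, h⟩
    simp only at h1
    linarith
  · rw [partialSum_succ_of_le v.1 (not_lt.mp h)]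

theorem partialSum_concave {d : ℕ} (v : OrderedProb d) (n : ℕ) :
    partialSum v.1 (n + 2) + partialSum v.1 n ≤ 2 * partialSum v.1 (n + 1) := by
  by_cases h : n + 1 < d
  · have h1 := partialSum_succ v.1 ⟨n, by omega⟩
    have h2 := partialSum_succ v.1 ⟨n + 1, h⟩
    have h3 := v.2.2 (show (⟨n, by omega⟩ : Fin d) ≤ ⟨n + 1, h⟩ by simp [Fin.le_def])
    simp only at h1 h2
    linarith
  · have h1 := partialSum_succ_of_le v.1 (not_lt.mp h)
    have h2 := partialSum_le_succ v n
    linarith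

theorem partialSum_le_one {d : ℕ} (v : OrderedProb d) (n : ℕ) : partialSum v.1 n ≤ 1 := by
  rw [← v.2.1.2]
  exact Finset.sum_le_sum_of_subset_of_nonneg (Finset.filter_subset _ _)
    fun i _ _ => v.2.1.1 i

theorem partialSum_nonneg {d : ℕ} (v : OrderedProb d) (n : ℕ) : 0 ≤ partialSum v.1 n :=
  Finset.sum_nonneg fun i _ => v.2.1.1 i

/-- The set of upper bounds is never empty: it contains `(1, 0, …, 0)`. -/
theorem upperBounds_orderedProb_nonempty {d : ℕ} [NeZero d] (U : Set (OrderedProb d)) :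
    (upperBounds U).Nonempty := by
  refine ⟨⟨Pi.single 0 1, single_mem_stdSimplex ℝ 0, ?_⟩, ?_⟩
  · intro i j hij
    by_cases hj : j = 0
    · subst hj
      have hi : i = 0 := le_antisymm hij (Fin.zero_le _)
      rw [hi]
    · rw [Pi.single_eq_of_ne hj]
      by_cases hi : i = 0
      · subst hi
        simp
      · rw [Pi.single_eq_of_ne hi]
  · intro v _ j
    rcases j with _ | j
    · rw [partialSum_zero, partialSum_zero]
    · refine (partialSum_le_one v _).trans (le_of_eq ?_)
      simp [partialSum]

/-- Ordered probability vectors have suprema under majorization: the pointwise infimum of the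
partial sums of all upper bounds is again the sequence of partial sums of such a vector. -/
theorem exists_isLUB_orderedProb {d : ℕ} [NeZero d] (U : Set (OrderedProb d)) :
    ∃ v, IsLUB U v := by
  have hne : Nonempty (upperBounds U) := (upperBounds_orderedProb_nonempty U).to_subtype
  let g : ℕ → ℝ := fun n => ⨅ v : upperBounds U, partialSum v.1.1 n
  have hbdd : ∀ n, BddBelow (Set.range fun v : upperBounds U => partialSum v.1.1 n) :=
    fun n => ⟨0, by rintro _ ⟨v, rfl⟩; exact partialSum_nonneg v.1 n⟩
  have hg_le : ∀ n (v : upperBounds U), g n ≤ partialSum v.1.1 n := fun n v => ciInf_le (hbdd n) v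
  have hmono : ∀ n, g n ≤ g (n + 1) := fun n =>
    le_ciInf fun v => (hg_le n v).trans (partialSum_le_succ v.1 n)
  have hconc : ∀ n, g (n + 2) + g n ≤ 2 * g (n + 1) := by
    intro n
    have h : (g (n + 2) + g n) / 2 ≤ g (n + 1) := le_ciInf fun v => by
      have h1 := hg_le (n + 2) v
      have h2 := hg_le n v
      have h3 := partialSum_concave v.1 n
      linarith
    linarith
  have hstep : Antitone fun n => g (n + 1) - g n := antitone_nat_of_succ_le fun n => by
    have := hconc n
    linarith
  have hsum : ∀ n, partialSum (fun i : Fin d => g (i.val + 1) - g i.val) n = g n := by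
    intro n
    induction n with
    | zero => simp [g, partialSum_zero]
    | succ n ih =>
      by_cases h : n < d
      · have h1 := partialSum_succ (fun i : Fin d => g (i.val + 1) - g i.val) ⟨n, h⟩
        simp only at h1
        rw [h1, ih]
        ring
      · have hd := not_lt.mp h
        rw [partialSum_succ_of_le _ hd, ih]
        simp only [g, partialSum_succ_of_le _ hd]
  have hone : g d = 1 := by
    have h : ∀ v : upperBounds U, partialSum v.1.1 d = 1 := fun v => by
      rw [partialSum_full]
      exact v.1.2.1.2
    simp [g, h]
  refine ⟨⟨fun i => g (i.val + 1) - g i.val, ⟨fun i => ?_, ?_⟩, fun i j hij => hstep hij⟩, ?_, ?_⟩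
  · have := hmono i.val
    simp only
    linarith
  · rw [← partialSum_full, hsum, hone]
  · intro u hu n
    rw [hsum]
    exact le_ciInf fun v => v.2 hu n
  · intro v hv n
    rw [hsum]
    exact hg_le n ⟨v, hv⟩

/-- The supremum of a set in the lattice of ordered probability vectors under majorization. -/
noncomputable def majSup {d : ℕ} [NeZero d] (U : Set (OrderedProb d)) : OrderedProb d :=
  (exists_isLUB_orderedProb U).choose

theorem isLUB_majSup {d : ℕ} [NeZero d] (U : Set (OrderedProb d)) : IsLUB U (majSup U) :=
  (exists_isLUB_orderedProb U).choose_spec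

/-- The rearrangement of a vector in non-increasing order. -/
noncomputable def sortDesc {d : ℕ} (u : Fin d → ℝ) : Fin d → ℝ :=
  u ∘ Tuple.sort (fun i => -u i)

theorem antitone_sortDesc {d : ℕ} (u : Fin d → ℝ) : Antitone (sortDesc u) := by
  intro i j hij
  have h := Tuple.monotone_sort (fun i => -u i) hij
  simpa [sortDesc] using h

/-- Density operators, as matrices in the incoherent (computational) basis. -/
def IsState {d : ℕ} (ρ : Matrix (Fin d) (Fin d) ℂ) : Prop :=
  ρ.PosSemidef ∧ ρ.trace = 1

/-- Incoherent states: states that are diagonal in the incoherent basis. -/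
def IsIncoherentState {d : ℕ} (ρ : Matrix (Fin d) (Fin d) ℂ) : Prop :=
  IsState ρ ∧ ρ.IsDiag

/-- The rank-one operator `|ψ⟩⟨ψ|`. -/
noncomputable def proj {d : ℕ} (ψ : EuclideanSpace ℂ (Fin d)) : Matrix (Fin d) (Fin d) ℂ :=
  Matrix.of fun i j => ψ i * star (ψ j)

/-- The coherence vector `(|⟨0|ψ⟩|², …, |⟨d-1|ψ⟩|²)` of a pure state. -/
noncomputable def pureCoherenceVector {d : ℕ} (ψ : EuclideanSpace ℂ (Fin d)) : Fin d → ℝ :=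
  fun i => ‖ψ i‖ ^ 2

/-- `{q k, ψ k}` is a pure state decomposition of `ρ`. -/
def IsPureDecomposition {d M : ℕ} (ρ : Matrix (Fin d) (Fin d) ℂ) (q : Fin M → ℝ)
    (ψ : Fin M → EuclideanSpace ℂ (Fin d)) : Prop :=
  q ∈ stdSimplex ℝ (Fin M) ∧ (∀ k, ‖ψ k‖ = 1) ∧ ρ = ∑ k, (q k : ℂ) • proj (ψ k)

/-- The set of the vectors `∑ k, q k • μ↓(ψ k)` over all pure state decompositions of `ρ`. -/
def pureDecompositionVectors {d : ℕ} (ρ : Matrix (Fin d) (Fin d) ℂ) : Set (OrderedProb d) :=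
  {u | ∃ (M : ℕ) (q : Fin M → ℝ) (ψ : Fin M → EuclideanSpace ℂ (Fin d)),
    IsPureDecomposition ρ q ψ ∧ u.1 = ∑ k, q k • sortDesc (pureCoherenceVector (ψ k))}

/-- The generalized coherence vector `ν(ρ)`. -/
noncomputable def coherenceVector {d : ℕ} [NeZero d] (ρ : Matrix (Fin d) (Fin d) ℂ) :
    Fin d → ℝ :=
  (majSup (pureDecompositionVectors ρ)).1

/-- `K` sends every incoherent basis vector `|i⟩` to a multiple of some `|g i⟩`. -/
def IsIncoherentMatrix {d : ℕ} (K : Matrix (Fin d) (Fin d) ℂ) : Prop :=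
  ∃ (g : Fin d → Fin d) (c : Fin d → ℂ),
    ∀ i, K *ᵥ Pi.single i 1 = c i • (Pi.single (g i) 1 : Fin d → ℂ)

/-- A finite family of incoherent Kraus operators. -/
def IsIncoherentKraus {d N : ℕ} (K : Fin N → Matrix (Fin d) (Fin d) ℂ) : Prop :=
  ∑ n, (K n)ᴴ * K n = 1 ∧ ∀ n, IsIncoherentMatrix (K n)

/-- Incoherent operations: maps with an incoherent Kraus representation (such a map is
automatically completely positive and trace preserving). -/
def IsIncoherentOperation {d : ℕ}
    (L : Matrix (Fin d) (Fin d) ℂ →ₗ[ℂ] Matrix (Fin d) (Fin d) ℂ) : Prop :=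
  ∃ (N : ℕ) (K : Fin N → Matrix (Fin d) (Fin d) ℂ),
    IsIncoherentKraus K ∧ ∀ X, L X = ∑ n, K n * X * (K n)ᴴ

/-- Maximally coherent states: those that incoherent operations can convert into every state. -/
def IsMaximallyCoherent {d : ℕ} (ρ : Matrix (Fin d) (Fin d) ℂ) : Prop :=
  IsState ρ ∧ ∀ σ, IsState σ → ∃ L, IsIncoherentOperation L ∧ L ρ = σ

/-- The unitary incoherent operator `∑ i, exp(𝕚 θ i) |π i⟩⟨i|`. -/
noncomputable def incoherentUnitary {d : ℕ} (π : Equiv.Perm (Fin d)) (θ : Fin d → ℝ) :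
    Matrix (Fin d) (Fin d) ℂ :=
  Matrix.of fun j i => if j = π i then Complex.exp (Complex.I * θ i) else 0

/-- The vector `∑ i, |i⟩ / √d`. -/
noncomputable def canonicalMCS (d : ℕ) : EuclideanSpace ℂ (Fin d) :=
  WithLp.toLp 2 fun _ => ((1 / Real.sqrt d : ℝ) : ℂ)

/-- The class of symmetric concave functions on the probability simplex, with values in `[0, 1]`,
that vanish at `(1, 0, …, 0)` and attain their maximum at `(1/d, …, 1/d)`. Values of `f` outside
the simplex play no role. -/
structure IsCoherenceFunction {d : ℕ} [NeZero d] (f : (Fin d → ℝ) → ℝ) : Prop where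
  mem_Icc : ∀ u ∈ stdSimplex ℝ (Fin d), f u ∈ Set.Icc (0 : ℝ) 1
  symmetric : ∀ u ∈ stdSimplex ℝ (Fin d), ∀ π : Equiv.Perm (Fin d), f (u ∘ π) = f u
  concave : ConcaveOn ℝ (stdSimplex ℝ (Fin d)) f
  vanish : f (Pi.single 0 1) = 0
  max_uniform : IsMaxOn f (stdSimplex ℝ (Fin d)) (fun _ => 1 / (d : ℝ))

/-- The coherence vector monotone `C(ρ) = f(ν(ρ))`. -/
noncomputable def coherenceVectorMonotone {d : ℕ} [NeZero d] (f : (Fin d → ℝ) → ℝ)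
    (ρ : Matrix (Fin d) (Fin d) ℂ) : ℝ :=
  f (coherenceVector ρ)

/-!
The argument compares partial sums of decreasingly ordered vectors. By Ky Fan's principle
(`sum_le_partialSum_sortDesc`, `exists_partialSum_sortDesc_eq`), the sum of the `j` largest entries
of `(|χ i|²)ᵢ`, called `peakMass χ j`, is the largest mass that `χ` has on `j` basis vectors.
Weights of an ensemble are absorbed into its vectors: if `X = ∑ k, |χ k⟩⟨χ k|` has trace `p`, then
`∑ k, peakMass (χ k) j` is at most `p` times the `j`-th partial sum of `ν(X / p)`
(`sum_peakMass_le`).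

The key inequality is `peakMass_le_sum_mulVec`: a family of incoherent Kraus operators `K n`
satisfies `peakMass χ j ≤ ∑ n, peakMass (K n χ) j`. Let `A` be the set of the `j` heaviest basis
vectors of `χ`. Each `K n` maps `A` into a set of at most `j` basis vectors; what `K n χ` carries
outside that set comes from the amplitudes of `χ` outside `A`, and by `∑ n, (K n)ᴴ * K n = 1` this
amounts, in total, to at most the mass of `χ` outside `A`. Applied to each vector of an arbitrary
ensemble of `ρ`, this gives `ν(ρ) ≤ ν(Λ(ρ))` (`majSup_le_majSup_map`) and
`ν(ρ) ≤ ∑ n, p n • ν(σ n)` (`majSup_le_of_eq_sum_outcomes`).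

A symmetric concave function is antitone for majorization (`IsCoherenceFunction.antitone`), because
a majorized vector lies in the convex hull of the permutations of the majorizing one
(`mem_convexHull_range_perm_of_le`). This turns both inequalities into monotonicity of `f ∘ ν`, the
selective one after a use of Jensen's inequality. Finally, `ν` is the greatest vector
`(1, 0, …, 0)` on incoherent states, and on a pure state whose amplitudes have equal moduli it is
majorized by the uniform vector, because every ensemble of a pure state consists of multiples of
the one vector.
-/

/-! ### Partial sums of sorted vectors -/

theorem partialSum_eq_one {d : ℕ} (v : OrderedProb d) {j : ℕ} (h : d ≤ j) :
    partialSum v.1 j = 1 := by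
  rw [← v.2.1.2, partialSum, Finset.filter_true_of_mem fun i _ => i.2.trans_le h]

theorem partialSum_sum_smul {d : ℕ} {ι : Type*} (s : Finset ι) (q : ι → ℝ) (u : ι → Fin d → ℝ)
    (j : ℕ) : partialSum (∑ k ∈ s, q k • u k) j = ∑ k ∈ s, q k * partialSum (u k) j := by
  simp only [partialSum, Finset.sum_apply, Pi.smul_apply, smul_eq_mul, Finset.mul_sum]
  exact Finset.sum_comm

theorem sum_le_partialSum_of_antitone {d : ℕ} {s : Fin d → ℝ} (hs : Antitone s)
    (h0 : ∀ i, 0 ≤ s i) {B : Finset (Fin d)} {j : ℕ} (hB : B.card ≤ j) :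
    ∑ i ∈ B, s i ≤ partialSum s j := by
  unfold partialSum
  set I : Finset (Fin d) := Finset.univ.filter fun i => i.val < j with hI
  rcases lt_or_ge j d with hj | hj
  · have hIc : I.card = j := by
      rw [hI, Fin.card_filter_val_lt, min_eq_right hj.le]
    have hcard : (B \ I).card ≤ (I \ B).card := by
      have h1 := Finset.card_sdiff_add_card_inter B I
      have h2 := Finset.card_sdiff_add_card_inter I B
      rw [Finset.inter_comm] at h2
      omega
    -- the entry with index `j` separates the entries in `B \ I` from those in `I \ B`
    have h1 : ∑ i ∈ B \ I, s i ≤ (B \ I).card • s ⟨j, hj⟩ :=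
      Finset.sum_le_card_nsmul _ _ _ fun i hi => hs (by
        simpa [hI, Fin.le_def] using (Finset.mem_sdiff.1 hi).2)
    have h2 : (I \ B).card • s ⟨j, hj⟩ ≤ ∑ i ∈ I \ B, s i :=
      Finset.card_nsmul_le_sum _ _ _ fun i hi => hs (by
        have : i.val < j := by simpa [hI] using (Finset.mem_sdiff.1 hi).1
        exact Fin.le_def.2 this.le)
    have h3 : (B \ I).card • s ⟨j, hj⟩ ≤ (I \ B).card • s ⟨j, hj⟩ :=
      nsmul_le_nsmul_left (h0 _) hcard
    rw [← Finset.sum_inter_add_sum_sdiff B I, ← Finset.sum_inter_add_sum_sdiff I B,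
      Finset.inter_comm I B]
    linarith
  · have : I = Finset.univ := Finset.filter_true_of_mem fun i _ => i.2.trans_le hj
    rw [this]
    exact Finset.sum_le_univ_sum_of_nonneg h0

theorem sum_le_partialSum_sortDesc {d : ℕ} {u : Fin d → ℝ} (h0 : ∀ i, 0 ≤ u i)
    {A : Finset (Fin d)} {j : ℕ} (hA : A.card ≤ j) :
    ∑ i ∈ A, u i ≤ partialSum (sortDesc u) j := by
  set τ := Tuple.sort fun i => -u i with hτ
  have h : ∑ i ∈ A, u i = ∑ i ∈ A.map τ.symm.toEmbedding, sortDesc u i := by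
    simp [sortDesc, ← hτ]
  rw [h]
  exact sum_le_partialSum_of_antitone (antitone_sortDesc u) (fun i => h0 _) (by simpa using hA)

theorem exists_partialSum_sortDesc_eq {d : ℕ} (u : Fin d → ℝ) (j : ℕ) :
    ∃ A : Finset (Fin d), A.card ≤ j ∧ partialSum (sortDesc u) j = ∑ i ∈ A, u i := by
  refine ⟨(Finset.univ.filter fun i : Fin d => i.val < j).map
    (Tuple.sort fun i => -u i).toEmbedding, ?_, ?_⟩
  · rw [Finset.card_map, Fin.card_filter_val_lt]
    exact min_le_right _ _
  · simp [partialSum, sortDesc]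

theorem partialSum_sortDesc_smul {d : ℕ} {u : Fin d → ℝ} (h0 : ∀ i, 0 ≤ u i) {c : ℝ}
    (hc : 0 ≤ c) (j : ℕ) :
    partialSum (sortDesc (c • u)) j = c * partialSum (sortDesc u) j := by
  apply le_antisymm
  · obtain ⟨A, hA, h⟩ := exists_partialSum_sortDesc_eq (c • u) j
    rw [h]
    simp only [Pi.smul_apply, smul_eq_mul, ← Finset.mul_sum]
    exact mul_le_mul_of_nonneg_left (sum_le_partialSum_sortDesc h0 hA) hc
  · obtain ⟨A, hA, h⟩ := exists_partialSum_sortDesc_eq u j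
    rw [h, Finset.mul_sum]
    exact sum_le_partialSum_sortDesc (u := c • u) (fun i => mul_nonneg hc (h0 i)) hA

theorem sortDesc_mem_stdSimplex {d : ℕ} {u : Fin d → ℝ} (hu : u ∈ stdSimplex ℝ (Fin d)) :
    sortDesc u ∈ stdSimplex ℝ (Fin d) :=
  ⟨fun _ => hu.1 _, (Equiv.sum_comp (Tuple.sort fun i => -u i) u).trans hu.2⟩

/-! ### Schur concavity -/

/-- Summation by parts: every partial sum of `a * x` dominates the last weight times the
corresponding partial sum of `x`. -/
theorem mul_partialSum_le_partialSum_mul {d : ℕ} {a x : Fin d → ℝ} (ha : Antitone a)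
    (hx : ∀ j, 0 ≤ partialSum x j) (n : ℕ) (hn : n < d) :
    a ⟨n, hn⟩ * partialSum x (n + 1) ≤ partialSum (a * x) (n + 1) := by
  induction n with
  | zero =>
    have h1 := partialSum_succ x ⟨0, hn⟩
    have h2 := partialSum_succ (a * x) ⟨0, hn⟩
    simp only [partialSum_zero, Pi.mul_apply] at h1 h2
    rw [h1, h2]
    simp
  | succ n ih =>
    have h1 := partialSum_succ x ⟨n + 1, hn⟩
    have h2 := partialSum_succ (a * x) ⟨n + 1, hn⟩
    have h3 := ih (by omega)
    have h4 := mul_le_mul_of_nonneg_right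
      (ha (show (⟨n, by omega⟩ : Fin d) ≤ ⟨n + 1, hn⟩ by simp [Fin.le_def])) (hx (n + 1))
    simp only [Pi.mul_apply] at h1 h2
    rw [h1, h2, mul_add]
    linarith

theorem sum_mul_le_sum_mul_of_le {d : ℕ} {u v : OrderedProb d} (huv : u ≤ v) {a : Fin d → ℝ}
    (ha : Antitone a) : ∑ i, a i * u.1 i ≤ ∑ i, a i * v.1 i := by
  rcases d with _ | n
  · simp
  have hsub : ∀ j, partialSum (v.1 - u.1) j = partialSum v.1 j - partialSum u.1 j := fun j => by
    simp [partialSum]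
  have h := mul_partialSum_le_partialSum_mul (x := v.1 - u.1) ha
    (fun j => by rw [hsub]; exact sub_nonneg.2 (huv j)) n n.lt_succ_self
  rw [hsub, partialSum_eq_one _ le_rfl, partialSum_eq_one _ le_rfl, partialSum_full] at h
  simp only [sub_self, mul_zero, Pi.mul_apply, Pi.sub_apply, mul_sub, Finset.sum_sub_distrib] at h
  linarith

/-- One half of the Hardy–Littlewood–Pólya–Rado theorem. A functional separating `u` from the
permutations of `v` would contradict the rearrangement inequality and summation by parts. -/
theorem mem_convexHull_range_perm_of_le {d : ℕ} {u v : OrderedProb d} (huv : u ≤ v) :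
    u.1 ∈ convexHull ℝ (Set.range fun π : Equiv.Perm (Fin d) => v.1 ∘ π) := by
  by_contra hu
  obtain ⟨F, c, hF, hc⟩ := geometric_hahn_banach_closed_point (convex_convexHull ℝ _)
    ((Set.finite_range _).isClosed_convexHull ℝ) hu
  let w : Fin d → ℝ := fun i => F (Pi.single i 1)
  have hFw : ∀ x, F x = ∑ i, w i * x i := fun x => by
    have := F.toLinearMap.pi_apply_eq_sum_univ x
    simp only [ContinuousLinearMap.coe_coe, smul_eq_mul] at this
    rw [this]
    refine Finset.sum_congr rfl fun i _ => ?_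
    rw [mul_comm]
    congr 2
    ext j
    simp [Pi.single_apply, eq_comm]
  set τ := Tuple.sort fun i => -w i with hτ
  have hanti : Antitone (w ∘ τ) := antitone_sortDesc w
  have h1 : ∑ i, w i * u.1 i ≤ ∑ i, (w ∘ τ) i * u.1 i := by
    have h := (show Monovary (w ∘ τ) u.1 from hanti.monovary u.2.2).sum_comp_perm_mul_le_sum_mul
      (σ := τ.symm)
    simpa using h
  have h2 := sum_mul_le_sum_mul_of_le huv hanti
  have h3 : ∑ i, (w ∘ τ) i * v.1 i = F (v.1 ∘ τ.symm) := by
    rw [hFw, ← Equiv.sum_comp τ fun i => w i * (v.1 ∘ τ.symm) i]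
    simp
  have h4 := hF _ (subset_convexHull ℝ _ ⟨τ.symm, rfl⟩)
  rw [hFw] at hc
  linarith

/-- Schur concavity: on the convex hull of the permutations of `v`, a concave function is bounded
below by its value at one of them, and by symmetry that value is `f v`. -/
theorem IsCoherenceFunction.antitone {d : ℕ} [NeZero d] {f : (Fin d → ℝ) → ℝ}
    (hf : IsCoherenceFunction f) {u v : OrderedProb d} (huv : u ≤ v) : f v.1 ≤ f u.1 := by
  have hsub : (Set.range fun π : Equiv.Perm (Fin d) => v.1 ∘ π) ⊆ stdSimplex ℝ (Fin d) := by
    rintro _ ⟨π, rfl⟩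
    exact ⟨fun _ => v.2.1.1 _, (Equiv.sum_comp π v.1).trans v.2.1.2⟩
  obtain ⟨_, ⟨π, rfl⟩, h⟩ :=
    hf.concave.exists_le_of_mem_convexHull hsub (mem_convexHull_range_perm_of_le huv)
  rwa [hf.symmetric _ v.2.1] at h

/-! ### Ensembles of unnormalised vectors -/

/-- The squared norm of a vector of amplitudes. -/
noncomputable def mass {d : ℕ} (χ : Fin d → ℂ) : ℝ :=
  ∑ i, ‖χ i‖ ^ 2

/-- The largest mass that a vector of amplitudes has on `j` basis vectors, as the sum of the
`j` largest squared moduli. -/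
noncomputable def peakMass {d : ℕ} (χ : Fin d → ℂ) (j : ℕ) : ℝ :=
  partialSum (sortDesc fun i => ‖χ i‖ ^ 2) j

theorem mass_nonneg {d : ℕ} (χ : Fin d → ℂ) : 0 ≤ mass χ :=
  Finset.sum_nonneg fun _ _ => sq_nonneg _

theorem eq_zero_of_mass_eq_zero {d : ℕ} {χ : Fin d → ℂ} (h : mass χ = 0) : χ = 0 := by
  funext i
  have := (Finset.sum_eq_zero_iff_of_nonneg fun i _ => sq_nonneg ‖χ i‖).1 h i (Finset.mem_univ i)
  simpa using this

theorem star_dotProduct_self_eq_mass {d : ℕ} (χ : Fin d → ℂ) : star χ ⬝ᵥ χ = (mass χ : ℂ) := by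
  simp only [dotProduct, mass, Pi.star_apply, Complex.ofReal_sum, Complex.ofReal_pow]
  exact Finset.sum_congr rfl fun i _ => Complex.conj_mul' _

theorem mass_eq_norm_sq {d : ℕ} (ψ : EuclideanSpace ℂ (Fin d)) : mass ψ = ‖ψ‖ ^ 2 :=
  (EuclideanSpace.norm_sq_eq ψ).symm

theorem peakMass_smul {d : ℕ} (c : ℂ) (χ : Fin d → ℂ) (j : ℕ) :
    peakMass (c • χ) j = ‖c‖ ^ 2 * peakMass χ j := by
  rw [peakMass, peakMass, ← partialSum_sortDesc_smul (fun i => sq_nonneg _) (sq_nonneg _)]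
  congr 2
  ext i
  simp [mul_pow]

theorem peakMass_zero {d : ℕ} (j : ℕ) : peakMass (0 : Fin d → ℂ) j = 0 := by
  simpa using peakMass_smul 0 (0 : Fin d → ℂ) j

theorem vecMulVec_smul_star {d : ℕ} (c : ℂ) (χ : Fin d → ℂ) :
    Matrix.vecMulVec (c • χ) (star (c • χ)) =
      ((‖c‖ ^ 2 : ℝ) : ℂ) • Matrix.vecMulVec χ (star χ) := by
  ext i j
  simp only [Matrix.vecMulVec_apply, Pi.smul_apply, Pi.star_apply, smul_eq_mul, star_mul',
    Matrix.smul_apply]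
  push_cast
  rw [← Complex.mul_conj' c]
  simp only [RCLike.star_def]
  ring

theorem proj_eq_vecMulVec {d : ℕ} (ψ : EuclideanSpace ℂ (Fin d)) :
    proj ψ = Matrix.vecMulVec ψ (star (ψ : Fin d → ℂ)) := rfl

/-- Normalisation of a vector; the zero vector gets weight zero and an arbitrary direction. -/
theorem exists_unit_vector {d : ℕ} [NeZero d] (χ : Fin d → ℂ) :
    ∃ ψ : EuclideanSpace ℂ (Fin d), ‖ψ‖ = 1 ∧
      Matrix.vecMulVec χ (star χ) = (mass χ : ℂ) • proj ψ ∧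
      ∀ j, peakMass χ j = mass χ * partialSum (sortDesc (pureCoherenceVector ψ)) j := by
  by_cases h : mass χ = 0
  · refine ⟨EuclideanSpace.single 0 1, by simp, ?_, fun j => ?_⟩
    · rw [h, eq_zero_of_mass_eq_zero h]
      simp
    · rw [h, eq_zero_of_mass_eq_zero h, peakMass_zero, zero_mul]
  · have hpos : 0 < mass χ := lt_of_le_of_ne (mass_nonneg χ) (Ne.symm h)
    set r := Real.sqrt (mass χ) with hr
    have hr2 : r ^ 2 = mass χ := Real.sq_sqrt hpos.le
    have hr0 : r ≠ 0 := (Real.sqrt_pos.2 hpos).ne'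
    set φ : Fin d → ℂ := ((r⁻¹ : ℝ) : ℂ) • χ with hφ
    have hχ : χ = (r : ℂ) • φ := by
      rw [hφ, smul_smul, ← Complex.ofReal_mul, mul_inv_cancel₀ hr0, Complex.ofReal_one, one_smul]
    have hn : ‖(r : ℂ)‖ ^ 2 = mass χ := by
      rw [Complex.norm_real, Real.norm_eq_abs, sq_abs, hr2]
    have hφ1 : mass φ = 1 := by
      have : mass φ = (r⁻¹) ^ 2 * mass χ := by
        simp [mass, hφ, mul_pow, Finset.mul_sum]
      rw [this, ← hr2, inv_pow, inv_mul_cancel₀ (pow_ne_zero 2 hr0)]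
    refine ⟨WithLp.toLp 2 φ, ?_, ?_, fun j => ?_⟩
    · have h1 := mass_eq_norm_sq (WithLp.toLp 2 φ)
      rw [hφ1] at h1
      nlinarith [norm_nonneg (WithLp.toLp 2 φ)]
    · conv_lhs => rw [hχ]
      rw [vecMulVec_smul_star, hn]
      rfl
    · conv_lhs => rw [hχ]
      rw [peakMass_smul, hn]
      rfl

theorem IsPureDecomposition.exists_ensemble {d M : ℕ} {ρ : Matrix (Fin d) (Fin d) ℂ}
    {q : Fin M → ℝ} {ψ : Fin M → EuclideanSpace ℂ (Fin d)} (h : IsPureDecomposition ρ q ψ) :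
    ∃ χ : Fin M → Fin d → ℂ, ρ = ∑ k, Matrix.vecMulVec (χ k) (star (χ k)) ∧
      ∀ j, partialSum (∑ k, q k • sortDesc (pureCoherenceVector (ψ k))) j =
        ∑ k, peakMass (χ k) j := by
  have hq : ∀ k, ‖((Real.sqrt (q k) : ℝ) : ℂ)‖ ^ 2 = q k := fun k => by
    rw [Complex.norm_real, Real.norm_eq_abs, sq_abs, Real.sq_sqrt (h.1.1 k)]
  refine ⟨fun k => ((Real.sqrt (q k) : ℝ) : ℂ) • (ψ k : Fin d → ℂ), ?_, fun j => ?_⟩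
  · rw [h.2.2]
    refine Finset.sum_congr rfl fun k _ => ?_
    rw [vecMulVec_smul_star, hq, proj_eq_vecMulVec]
  · rw [partialSum_sum_smul]
    refine Finset.sum_congr rfl fun k _ => ?_
    rw [peakMass_smul, hq]
    rfl

theorem antitone_sum_smul {d : ℕ} {ι : Type*} (s : Finset ι) {q : ι → ℝ} {u : ι → Fin d → ℝ}
    (hq : ∀ k ∈ s, 0 ≤ q k) (hu : ∀ k ∈ s, Antitone (u k)) :
    Antitone (∑ k ∈ s, q k • u k) := fun i j hij => by
  simp only [Finset.sum_apply, Pi.smul_apply, smul_eq_mul]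
  exact Finset.sum_le_sum fun k hk => mul_le_mul_of_nonneg_left (hu k hk hij) (hq k hk)

/-- Any ensemble of unnormalised vectors bounds the coherence vector of the normalised
operator from below; for total mass zero both sides vanish. -/
theorem sum_peakMass_le {d : ℕ} [NeZero d] {ι : Type*} [Fintype ι]
    {X : Matrix (Fin d) (Fin d) ℂ} {χ : ι → Fin d → ℂ}
    (hX : X = ∑ k, Matrix.vecMulVec (χ k) (star (χ k))) {p : ℝ} (hp : p = ∑ k, mass (χ k))
    (j : ℕ) :
    ∑ k, peakMass (χ k) j ≤ p * partialSum (coherenceVector ((p : ℂ)⁻¹ • X)) j := by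
  by_cases h0 : p = 0
  · rw [h0, zero_mul]
    refine (Finset.sum_eq_zero fun k _ => ?_).le
    rw [h0] at hp
    rw [eq_zero_of_mass_eq_zero ((Finset.sum_eq_zero_iff_of_nonneg fun k _ =>
      mass_nonneg (χ k)).1 hp.symm k (Finset.mem_univ k)), peakMass_zero]
  have hpos : 0 < p := lt_of_le_of_ne
    (hp ▸ Finset.sum_nonneg fun k _ => mass_nonneg _) (Ne.symm h0)
  choose ψ h1 h2 h3 using fun k => exists_unit_vector (χ k)
  let e := (Fintype.equivFin ι).symm
  have hq : (fun k => p⁻¹ * mass (χ (e k))) ∈ stdSimplex ℝ (Fin (Fintype.card ι)) := by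
    refine ⟨fun k => mul_nonneg (inv_nonneg.2 hpos.le) (mass_nonneg _), ?_⟩
    rw [← Finset.mul_sum, Equiv.sum_comp e fun k => mass (χ k), ← hp, inv_mul_cancel₀ h0]
  have hsimp : ∀ k, sortDesc (pureCoherenceVector (ψ k)) ∈ stdSimplex ℝ (Fin d) := fun k =>
    sortDesc_mem_stdSimplex ⟨fun i => sq_nonneg _, by
      have := mass_eq_norm_sq (ψ k)
      rw [h1, one_pow] at this
      exact this⟩
  let u : OrderedProb d :=
    ⟨∑ k, (p⁻¹ * mass (χ (e k))) • sortDesc (pureCoherenceVector (ψ (e k))),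
      (convex_stdSimplex ℝ (Fin d)).sum_mem (fun k _ => hq.1 k) hq.2 fun k _ => hsimp _,
      antitone_sum_smul _ (fun k _ => hq.1 k) fun k _ => antitone_sortDesc _⟩
  have hu : u ∈ pureDecompositionVectors ((p : ℂ)⁻¹ • X) := by
    refine ⟨_, _, fun k => ψ (e k), ⟨hq, fun k => h1 _, ?_⟩, rfl⟩
    rw [hX, ← Equiv.sum_comp e, Finset.smul_sum]
    refine Finset.sum_congr rfl fun k _ => ?_
    rw [h2, smul_smul]
    push_cast
    rfl
  have h := (isLUB_majSup _).1 hu j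
  have hu' : partialSum u.1 j = p⁻¹ * ∑ k, peakMass (χ k) j := by
    rw [← Equiv.sum_comp e, Finset.mul_sum]
    simp only [u, partialSum_sum_smul, h3, mul_assoc]
  rw [hu'] at h
  calc _ = p * (p⁻¹ * ∑ k, peakMass (χ k) j) := by rw [← mul_assoc, mul_inv_cancel₀ h0, one_mul]
    _ ≤ _ := mul_le_mul_of_nonneg_left h hpos.le

theorem trace_sum_vecMulVec_star {d : ℕ} {ι : Type*} [Fintype ι] (χ : ι → Fin d → ℂ) :
    (∑ k, Matrix.vecMulVec (χ k) (star (χ k))).trace = ((∑ k, mass (χ k) : ℝ) : ℂ) := by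
  rw [Matrix.trace_sum, Complex.ofReal_sum]
  refine Finset.sum_congr rfl fun k _ => ?_
  rw [Matrix.trace_vecMulVec, dotProduct_comm, star_dotProduct_self_eq_mass]

theorem sum_peakMass_le_of_mass_eq_one {d : ℕ} [NeZero d] {ι : Type*} [Fintype ι]
    {X : Matrix (Fin d) (Fin d) ℂ} {χ : ι → Fin d → ℂ}
    (hX : X = ∑ k, Matrix.vecMulVec (χ k) (star (χ k))) (h1 : ∑ k, mass (χ k) = 1) (j : ℕ) :
    ∑ k, peakMass (χ k) j ≤ partialSum (coherenceVector X) j := by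
  simpa using sum_peakMass_le hX h1.symm j

/-- A decomposition vector of a state comes from an ensemble whose peak masses add up to the
partial sums of the vector. -/
theorem exists_ensemble_of_mem {d : ℕ} {ρ : Matrix (Fin d) (Fin d) ℂ} (hρ : ρ.trace = 1)
    {u : OrderedProb d} (hu : u ∈ pureDecompositionVectors ρ) :
    ∃ (M : ℕ) (χ : Fin M → Fin d → ℂ), ρ = ∑ k, Matrix.vecMulVec (χ k) (star (χ k)) ∧
      ∑ k, mass (χ k) = 1 ∧ ∀ j, partialSum u.1 j = ∑ k, peakMass (χ k) j := by
  obtain ⟨M, q, ψ, h, hu⟩ := hu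
  obtain ⟨χ, hχ, hj⟩ := h.exists_ensemble
  refine ⟨M, χ, hχ, ?_, hu ▸ hj⟩
  rw [hχ, trace_sum_vecMulVec_star] at hρ
  exact_mod_cast hρ

/-! ### Incoherent Kraus operators -/

theorem IsIncoherentMatrix.exists_support {d : ℕ} {K : Matrix (Fin d) (Fin d) ℂ}
    (h : IsIncoherentMatrix K) : ∃ g : Fin d → Fin d, ∀ b i, b ≠ g i → K b i = 0 := by
  obtain ⟨g, c, h⟩ := h
  refine ⟨g, fun b i hb => ?_⟩
  have := congrFun (h i) b
  simpa [hb] using this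

theorem sum_mass_mulVec {d N : ℕ} {K : Fin N → Matrix (Fin d) (Fin d) ℂ}
    (hK : ∑ n, (K n)ᴴ * K n = 1) (χ : Fin d → ℂ) : ∑ n, mass (K n *ᵥ χ) = mass χ := by
  have h : (((∑ n, mass (K n *ᵥ χ) : ℝ)) : ℂ) = (mass χ : ℂ) := by
    have h1 : ∑ n, ((K n)ᴴ * K n) *ᵥ χ = χ := by rw [← Matrix.sum_mulVec, hK, Matrix.one_mulVec]
    rw [← star_dotProduct_self_eq_mass χ]
    nth_rw 3 [← h1]
    rw [dotProduct_sum, Complex.ofReal_sum]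
    refine Finset.sum_congr rfl fun n _ => ?_
    rw [← star_dotProduct_self_eq_mass, Matrix.star_mulVec, ← Matrix.dotProduct_mulVec,
      Matrix.mulVec_mulVec]
  exact_mod_cast h

/-- Incoherent Kraus operators do not decrease the mass carried by the heaviest `j` basis vectors.
The mass of `K n *ᵥ χ` outside the image of a set `A` of basis vectors comes only from the
amplitudes of `χ` outside `A`, and trace preservation bounds it by their mass. -/
theorem peakMass_le_sum_mulVec {d N : ℕ} {K : Fin N → Matrix (Fin d) (Fin d) ℂ}
    (hK : IsIncoherentKraus K) (χ : Fin d → ℂ) (j : ℕ) :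
    peakMass χ j ≤ ∑ n, peakMass (K n *ᵥ χ) j := by
  obtain ⟨A, hA, h⟩ := exists_partialSum_sortDesc_eq (fun i => ‖χ i‖ ^ 2) j
  choose g hg using fun n => (hK.2 n).exists_support
  let χ' : Fin d → ℂ := fun i => if i ∈ A then 0 else χ i
  have hout : ∀ n, ∀ b ∈ (A.image (g n))ᶜ, (K n *ᵥ χ) b = (K n *ᵥ χ') b := fun n b hb => by
    simp only [Matrix.mulVec, dotProduct]
    refine Finset.sum_congr rfl fun i _ => ?_
    by_cases hi : i ∈ A
    · have : b ≠ g n i := fun hbi =>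
        Finset.mem_compl.1 hb (hbi ▸ Finset.mem_image_of_mem _ hi)
      simp [hg n b i this]
    · simp [χ', hi]
  have h1 : ∀ n, mass (K n *ᵥ χ) ≤ peakMass (K n *ᵥ χ) j + mass (K n *ᵥ χ') := fun n => by
    have hin : ∑ b ∈ A.image (g n), ‖(K n *ᵥ χ) b‖ ^ 2 ≤ peakMass (K n *ᵥ χ) j :=
      sum_le_partialSum_sortDesc (u := fun b => ‖(K n *ᵥ χ) b‖ ^ 2) (fun _ => sq_nonneg _)
        (Finset.card_image_le.trans hA)
    have hrest : ∑ b ∈ (A.image (g n))ᶜ, ‖(K n *ᵥ χ) b‖ ^ 2 ≤ mass (K n *ᵥ χ') := by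
      rw [Finset.sum_congr rfl fun b hb => by rw [hout n b hb]]
      exact Finset.sum_le_univ_sum_of_nonneg fun _ => sq_nonneg _
    rw [mass, ← Finset.sum_add_sum_compl (A.image (g n))]
    exact add_le_add hin hrest
  have h2 := Finset.sum_le_sum fun n (_ : n ∈ Finset.univ) => h1 n
  rw [Finset.sum_add_distrib, sum_mass_mulVec hK.1, sum_mass_mulVec hK.1] at h2
  have h3 : mass χ = ∑ i ∈ A, ‖χ i‖ ^ 2 + mass χ' := by
    have h4 : mass χ' = ∑ i ∈ Aᶜ, ‖χ i‖ ^ 2 := by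
      rw [mass, ← Finset.sum_add_sum_compl A, Finset.sum_eq_zero, zero_add]
      · exact Finset.sum_congr rfl fun i hi => by simp [χ', Finset.mem_compl.1 hi]
      · intro i hi
        simp [χ', hi]
    rw [h4, mass, Finset.sum_add_sum_compl]
  have h5 : peakMass χ j = ∑ i ∈ A, ‖χ i‖ ^ 2 := h
  linarith

theorem mul_vecMulVec_star_mul {d : ℕ} (K : Matrix (Fin d) (Fin d) ℂ) (χ : Fin d → ℂ) :
    K * Matrix.vecMulVec χ (star χ) * Kᴴ = Matrix.vecMulVec (K *ᵥ χ) (star (K *ᵥ χ)) := by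
  rw [Matrix.mul_vecMulVec, Matrix.vecMulVec_mul, Matrix.star_mulVec]

/-! ### Behaviour of the coherence vector under incoherent operations -/

theorem majSup_le_majSup_map {d : ℕ} [NeZero d] {ρ : Matrix (Fin d) (Fin d) ℂ}
    (hρ : ρ.trace = 1) {L : Matrix (Fin d) (Fin d) ℂ →ₗ[ℂ] Matrix (Fin d) (Fin d) ℂ}
    (hL : IsIncoherentOperation L) :
    majSup (pureDecompositionVectors ρ) ≤ majSup (pureDecompositionVectors (L ρ)) := by
  obtain ⟨N, K, hK, hLK⟩ := hL
  refine (isLUB_majSup _).2 fun u hu j => ?_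
  obtain ⟨M, χ, hχ, h1, hj⟩ := exists_ensemble_of_mem hρ hu
  have hX : L ρ = ∑ x : Fin M × Fin N,
      Matrix.vecMulVec (K x.2 *ᵥ χ x.1) (star (K x.2 *ᵥ χ x.1)) := by
    rw [hLK, hχ, Fintype.sum_prod_type_right]
    simp only [Matrix.mul_sum, Matrix.sum_mul, mul_vecMulVec_star_mul]
  have hm : ∑ x : Fin M × Fin N, mass (K x.2 *ᵥ χ x.1) = 1 := by
    rw [Fintype.sum_prod_type]
    simp only [sum_mass_mulVec hK.1, h1]
  refine le_trans ?_ (sum_peakMass_le_of_mass_eq_one hX hm j)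
  rw [hj, Fintype.sum_prod_type]
  exact Finset.sum_le_sum fun k _ => peakMass_le_sum_mulVec hK _ j

theorem IsState.outcomeProb_mem_stdSimplex {d N : ℕ} {ρ : Matrix (Fin d) (Fin d) ℂ} (hρ : IsState ρ)
    {K : Fin N → Matrix (Fin d) (Fin d) ℂ} (hK : ∑ n, (K n)ᴴ * K n = 1) :
    (fun n => (K n * ρ * (K n)ᴴ).trace.re) ∈ stdSimplex ℝ (Fin N) := by
  refine ⟨fun n => ?_, ?_⟩
  · exact (Complex.le_def.1 (hρ.1.mul_mul_conjTranspose_same (K n)).trace_nonneg).1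
  · have h : ∑ n, (K n * ρ * (K n)ᴴ).trace = 1 := by
      calc _ = ∑ n, ((K n)ᴴ * K n * ρ).trace :=
            Finset.sum_congr rfl fun n _ => by rw [Matrix.trace_mul_comm, Matrix.mul_assoc]
        _ = 1 := by rw [← Matrix.trace_sum, ← Finset.sum_mul, hK, one_mul, hρ.2]
    simp only [← Complex.re_sum, h, Complex.one_re]

/-- The coherence vector of a state is majorized by the average of those of the outcomes of a
selective incoherent operation. -/
theorem majSup_le_of_eq_sum_outcomes {d N : ℕ} [NeZero d] {ρ : Matrix (Fin d) (Fin d) ℂ}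
    (hρ : IsState ρ) {K : Fin N → Matrix (Fin d) (Fin d) ℂ} (hK : IsIncoherentKraus K)
    {p : Fin N → ℝ} (hp : ∀ n, p n = (K n * ρ * (K n)ᴴ).trace.re) (w : OrderedProb d)
    (hw : w.1 = ∑ n, p n • coherenceVector (((p n)⁻¹ : ℂ) • (K n * ρ * (K n)ᴴ))) :
    majSup (pureDecompositionVectors ρ) ≤ w := by
  refine (isLUB_majSup _).2 fun u hu j => ?_
  obtain ⟨M, χ, hχ, h1, hj⟩ := exists_ensemble_of_mem hρ.2 hu
  rw [hj, hw, partialSum_sum_smul]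
  calc ∑ k, peakMass (χ k) j ≤ ∑ k, ∑ n, peakMass (K n *ᵥ χ k) j :=
        Finset.sum_le_sum fun k _ => peakMass_le_sum_mulVec hK _ j
    _ = ∑ n, ∑ k, peakMass (K n *ᵥ χ k) j := Finset.sum_comm
    _ ≤ _ := Finset.sum_le_sum fun n _ => by
      have hX : K n * ρ * (K n)ᴴ =
          ∑ k, Matrix.vecMulVec (K n *ᵥ χ k) (star (K n *ᵥ χ k)) := by
        rw [hχ]
        simp only [Matrix.mul_sum, Matrix.sum_mul, mul_vecMulVec_star_mul]
      refine sum_peakMass_le hX ?_ j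
      rw [hp, hX, trace_sum_vecMulVec_star, Complex.ofReal_re]

/-! ### Incoherent and maximally coherent states -/

/-- The vector `(1, 0, …, 0)`, the greatest element in the majorization order. -/
def topVector (d : ℕ) [NeZero d] : OrderedProb d :=
  ⟨Pi.single 0 1, single_mem_stdSimplex ℝ 0, fun i j hij => by
    by_cases hj : j = 0
    · rw [le_antisymm (hj ▸ hij) (Fin.zero_le i), hj]
    · rw [Pi.single_eq_of_ne hj]
      exact (single_mem_stdSimplex ℝ (0 : Fin d)).1 i⟩

/-- The uniform probability vector. -/
noncomputable def uniformVector (d : ℕ) [NeZero d] : OrderedProb d :=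
  ⟨fun _ => 1 / (d : ℝ), ⟨fun _ => by positivity, by
    simp [NeZero.ne d]⟩, antitone_const⟩

/-- The decomposition of a diagonal state into basis vectors attains the top vector. -/
theorem topVector_le_majSup {d : ℕ} [NeZero d] {ρ : Matrix (Fin d) (Fin d) ℂ}
    (hρ : IsIncoherentState ρ) : topVector d ≤ majSup (pureDecompositionVectors ρ) := by
  have hdiag : ∀ k, 0 ≤ ρ k k := fun k => hρ.1.1.diag_nonneg
  let c : Fin d → ℂ := fun k => ((Real.sqrt (ρ k k).re : ℝ) : ℂ)
  have hc : ∀ k, ‖c k‖ ^ 2 = (ρ k k).re := fun k => by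
    rw [Complex.norm_real, Real.norm_eq_abs, sq_abs,
      Real.sq_sqrt (Complex.le_def.1 (hdiag k)).1]
  let χ : Fin d → Fin d → ℂ := fun k => c k • Pi.single k 1
  have hX : ρ = ∑ k, Matrix.vecMulVec (χ k) (star (χ k)) := by
    ext i j
    simp only [χ, vecMulVec_smul_star, hc, Matrix.sum_apply, Matrix.smul_apply,
      Matrix.vecMulVec_apply, Pi.star_apply, Pi.single_apply, smul_eq_mul]
    rw [Finset.sum_eq_single i (fun k _ hk => by simp [hk.symm]) (by simp)]
    by_cases hij : i = j
    · subst hij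
      simpa using (Complex.conj_eq_iff_re.1 (Complex.conj_eq_iff_im.2
        (Complex.le_def.1 (hdiag i)).2.symm)).symm
    · simp [hρ.2 hij, Ne.symm hij]
  have hm : ∑ k, mass (χ k) = 1 := by
    have h := hρ.1.2
    rw [hX, trace_sum_vecMulVec_star] at h
    exact_mod_cast h
  intro j
  rcases j with _ | j
  · rw [partialSum_zero, partialSum_zero]
  refine (partialSum_le_one _ _).trans ?_
  refine le_trans ?_ (sum_peakMass_le_of_mass_eq_one hX hm (j + 1))
  rw [← hm]
  refine Finset.sum_le_sum fun k _ => ?_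
  have h1 : mass (χ k) = ∑ i ∈ {k}, ‖χ k i‖ ^ 2 := by
    rw [Finset.sum_singleton]
    exact Finset.sum_eq_single k (fun i _ hi => by simp [χ, hi]) (by simp)
  rw [h1]
  exact sum_le_partialSum_sortDesc (u := fun i => ‖χ k i‖ ^ 2) (fun _ => sq_nonneg _) (by simp)

/-- Every ensemble of a pure state `|φ⟩⟨φ|` consists of multiples of `φ`, here in the form of
vanishing `2 × 2` minors. -/
theorem mul_eq_mul_of_vecMulVec_eq_sum {d : ℕ} {ι : Type*} [Fintype ι] {φ : Fin d → ℂ}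
    {χ : ι → Fin d → ℂ}
    (h : Matrix.vecMulVec φ (star φ) = ∑ k, Matrix.vecMulVec (χ k) (star (χ k)))
    (k : ι) (a b : Fin d) : φ b * χ k a = φ a * χ k b := by
  have he : ∀ a b, ∑ k, χ k a * star (χ k b) = φ a * star (φ b) := fun a b => by
    have := congrFun (congrFun h a) b
    simp only [Matrix.sum_apply, Matrix.vecMulVec_apply, Pi.star_apply] at this
    exact this.symm
  have hsum : ∑ k, ‖φ b * χ k a - φ a * χ k b‖ ^ 2 = 0 := by
    have : ((∑ k, ‖φ b * χ k a - φ a * χ k b‖ ^ 2 : ℝ) : ℂ) = 0 := by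
      calc _ = ∑ k, (φ b * star (φ b) * (χ k a * star (χ k a))
              - φ b * star (φ a) * (χ k a * star (χ k b))
              - φ a * star (φ b) * (χ k b * star (χ k a))
              + φ a * star (φ a) * (χ k b * star (χ k b))) := by
            rw [Complex.ofReal_sum]
            refine Finset.sum_congr rfl fun k _ => ?_
            rw [Complex.ofReal_pow, ← Complex.mul_conj']
            simp only [map_sub, map_mul, RCLike.star_def]
            ring
        _ = 0 := by
            simp only [Finset.sum_add_distrib, Finset.sum_sub_distrib, ← Finset.mul_sum, he]
            ring
    exact_mod_cast this
  have := (Finset.sum_eq_zero_iff_of_nonneg fun k _ => sq_nonneg _).1 hsum k (Finset.mem_univ k)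
  exact sub_eq_zero.1 (norm_eq_zero.1 (pow_eq_zero_iff two_ne_zero |>.1 this))

/-- Every vector of an ensemble of `|φ⟩⟨φ|` is proportional to `φ`, so its mass is spread
uniformly. -/
theorem majSup_le_uniformVector {d : ℕ} [NeZero d] {φ : Fin d → ℂ}
    (hφ : ∀ i, ‖φ i‖ ^ 2 = 1 / (d : ℝ)) (h1 : (Matrix.vecMulVec φ (star φ)).trace = 1) :
    majSup (pureDecompositionVectors (Matrix.vecMulVec φ (star φ))) ≤ uniformVector d := by
  have hd : (d : ℝ) ≠ 0 := Nat.cast_ne_zero.2 (NeZero.ne d)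
  refine (isLUB_majSup _).2 fun u hu j => ?_
  obtain ⟨M, χ, hχ, hm, hj⟩ := exists_ensemble_of_mem h1 hu
  have hconst : ∀ k a b, ‖χ k a‖ ^ 2 = ‖χ k b‖ ^ 2 := fun k a b => by
    have h := congrArg (fun z => ‖z‖ ^ 2) (mul_eq_mul_of_vecMulVec_eq_sum hχ k a b)
    simp only [norm_mul, mul_pow, hφ] at h
    exact mul_left_cancel₀ (one_div_ne_zero hd) h
  have hval : ∀ k a, ‖χ k a‖ ^ 2 = mass (χ k) * (1 / d) := fun k a => by
    rw [mass, Finset.sum_congr rfl fun b _ => hconst k b a]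
    simp only [Finset.sum_const, Finset.card_univ, Fintype.card_fin, nsmul_eq_mul]
    field_simp
  calc partialSum u.1 j = ∑ k, peakMass (χ k) j := hj j
    _ ≤ ∑ k, mass (χ k) * partialSum (uniformVector d).1 j :=
        Finset.sum_le_sum fun k _ => by
          obtain ⟨A, hA, h⟩ := exists_partialSum_sortDesc_eq (fun i => ‖χ k i‖ ^ 2) j
          rw [peakMass, h, Finset.sum_congr rfl fun a _ => hval k a, ← Finset.mul_sum]
          exact mul_le_mul_of_nonneg_left (sum_le_partialSum_of_antitone (uniformVector d).2.2
            (uniformVector d).2.1.1 hA) (mass_nonneg _)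
    _ = partialSum (uniformVector d).1 j := by rw [← Finset.sum_mul, hm, one_mul]

theorem norm_sq_incoherentUnitary_mulVec {d : ℕ} (π : Equiv.Perm (Fin d)) (θ : Fin d → ℝ)
    (j : Fin d) :
    ‖(incoherentUnitary π θ *ᵥ (canonicalMCS d : Fin d → ℂ)) j‖ ^ 2 = 1 / (d : ℝ) := by
  have h : (incoherentUnitary π θ *ᵥ (canonicalMCS d : Fin d → ℂ)) j =
      Complex.exp (Complex.I * θ (π.symm j)) * ((1 / Real.sqrt d : ℝ) : ℂ) := by
    simp only [Matrix.mulVec, dotProduct, incoherentUnitary, canonicalMCS, Matrix.of_apply]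
    rw [Finset.sum_eq_single (π.symm j)
      (fun i _ hi => by
        have : j ≠ π i := fun hj => hi (by rw [hj, Equiv.symm_apply_apply])
        simp [this]) (by simp)]
    simp
  rw [h, norm_mul, mul_comm Complex.I, Complex.norm_exp_ofReal_mul_I, one_mul, Complex.norm_real,
    Real.norm_eq_abs, sq_abs, div_pow, one_pow, Real.sq_sqrt d.cast_nonneg]

/-! ### The coherence vector monotones -/

theorem mainTheorem7 {d : ℕ} [NeZero d] (f : (Fin d → ℝ) → ℝ) (hf : IsCoherenceFunction f) :
    -- vanishing on incoherent states
    (∀ ρ : Matrix (Fin d) (Fin d) ℂ, IsIncoherentState ρ → coherenceVectorMonotone f ρ = 0) ∧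
    -- monotonicity under incoherent operations
    (∀ (ρ : Matrix (Fin d) (Fin d) ℂ)
        (L : Matrix (Fin d) (Fin d) ℂ →ₗ[ℂ] Matrix (Fin d) (Fin d) ℂ),
      IsState ρ → IsIncoherentOperation L →
        coherenceVectorMonotone f (L ρ) ≤ coherenceVectorMonotone f ρ) ∧
    -- monotonicity under selective incoherent operations (outcomes of probability 0 contribute 0)
    (∀ (ρ : Matrix (Fin d) (Fin d) ℂ) (N : ℕ) (K : Fin N → Matrix (Fin d) (Fin d) ℂ)
        (p : Fin N → ℝ) (σ : Fin N → Matrix (Fin d) (Fin d) ℂ),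
      IsState ρ → IsIncoherentKraus K →
      (∀ n, p n = (K n * ρ * (K n)ᴴ).trace.re) →
      (∀ n, σ n = ((p n)⁻¹ : ℂ) • (K n * ρ * (K n)ᴴ)) →
        ∑ n, p n * coherenceVectorMonotone f (σ n) ≤ coherenceVectorMonotone f ρ) ∧
    -- the maximum over all states is attained at every maximally coherent state
    (∀ ρ : Matrix (Fin d) (Fin d) ℂ, IsMaximallyCoherent ρ →
      IsMaxOn (coherenceVectorMonotone f) {σ | IsState σ} ρ) ∧
    -- in particular on the orbit of the canonical maximally coherent state
    (∀ (π : Equiv.Perm (Fin d)) (θ : Fin d → ℝ),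
      IsState (incoherentUnitary π θ * proj (canonicalMCS d) * (incoherentUnitary π θ)ᴴ) ∧
      IsMaxOn (coherenceVectorMonotone f) {σ | IsState σ}
        (incoherentUnitary π θ * proj (canonicalMCS d) * (incoherentUnitary π θ)ᴴ)) := by
  refine ⟨fun ρ hρ => ?_, fun ρ L hρ hL => hf.antitone (majSup_le_majSup_map hρ.2 hL),
    fun ρ N K p σ hρ hK hp hσ => ?_, fun ρ hρ σ hσ => ?_, fun π θ => ?_⟩
  · exact le_antisymm ((hf.antitone (topVector_le_majSup hρ)).trans_eq hf.vanish)
      (hf.mem_Icc _ (majSup _).2.1).1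
  · have hp1 : p ∈ stdSimplex ℝ (Fin N) := by
      rw [funext hp]
      exact hρ.outcomeProb_mem_stdSimplex hK.1
    have hν : ∀ n, coherenceVector (σ n) ∈ stdSimplex ℝ (Fin d) := fun n => (majSup _).2.1
    let w : OrderedProb d := ⟨∑ n, p n • coherenceVector (σ n),
      (convex_stdSimplex ℝ (Fin d)).sum_mem (fun n _ => hp1.1 n) hp1.2 fun n _ => hν n,
      antitone_sum_smul _ (fun n _ => hp1.1 n) fun n _ => (majSup _).2.2⟩
    calc ∑ n, p n * f (coherenceVector (σ n)) ≤ f w.1 :=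
          hf.concave.le_map_sum (fun n _ => hp1.1 n) hp1.2 fun n _ => hν n
      _ ≤ f (coherenceVector ρ) :=
          hf.antitone (majSup_le_of_eq_sum_outcomes hρ hK hp w (by simp only [w, hσ]))
  · obtain ⟨L, hL, rfl⟩ := hρ.2 σ hσ
    exact hf.antitone (majSup_le_majSup_map hρ.1.2 hL)
  · set φ := incoherentUnitary π θ *ᵥ (canonicalMCS d : Fin d → ℂ)
    have hφ : ∀ j, ‖φ j‖ ^ 2 = 1 / (d : ℝ) := norm_sq_incoherentUnitary_mulVec π θ
    have hX : incoherentUnitary π θ * proj (canonicalMCS d) * (incoherentUnitary π θ)ᴴ =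
        Matrix.vecMulVec φ (star φ) := by
      rw [proj_eq_vecMulVec, mul_vecMulVec_star_mul]
    have htr : (Matrix.vecMulVec φ (star φ)).trace = 1 := by
      have : mass φ = 1 := by simp [mass, hφ, NeZero.ne d]
      rw [Matrix.trace_vecMulVec, dotProduct_comm, star_dotProduct_self_eq_mass, this,
        Complex.ofReal_one]
    rw [hX]
    refine ⟨⟨Matrix.posSemidef_vecMulVec_self_star φ, htr⟩, fun σ _ => ?_⟩
    exact (hf.max_uniform (majSup (pureDecompositionVectors σ)).2.1).trans
      (hf.antitone (majSup_le_uniformVector hφ htr))
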